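/- There are universal constants $c, c' > 0$ and $C \ge 0$ such that the following holds for every integer $k \ge 2$, every non-empty domain $\mathcal X$ and every label set $\mathcal Y$ with $|\mathcal Y| = k$. Let $\mathcal P \subseteq (\mathcal X\times\mathcal Y)^\star$ be the set of all finite sequences $p$ of examples for which there is a label $y^\star\in\mathcal Y$ such that all but at most $k$ of the examples $(x,y)$ in $p$ satisfy $y = y^\star$ (the class of constant functions with budget $k$). Then $\mathcal P$ is a pattern class, i.e. non-empty and closed under deleting examples from a sequence, and $$\mathsf{opt}^{\mathrm{adap}}_{\mathrm{bandit}}(\mathcal P)\ \ge\ c\, k\cdot \mathsf{opt}^{\mathrm{obl}}_{\mathrm{bandit}}(\mathcal P),\qquad \mathsf{opt}^{\mathrm{adap}}_{\mathrm{bandit}}(\mathcal P)\ \ge\ c' k^2,\qquad \mathsf{opt}^{\mathrm{obl}}_{\mathrm{bandit}}(\mathcal P)\ \le\ C k .$$ Here a feedback sequence is a finite sequence of triples (instance, correct/incorrect, predicted label), and a learner is a function that maps a past feedback sequence and a current instance to a probability distribution on $\mathcal Y$, from which its prediction is drawn; after each round it is told only whether the prediction was correct. Then - $\mathsf{opt}^{\mathrm{obl}}_{\mathrm{bandit}}(\mathcal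 P)$ is the infimum over learners of the supremum over $S\in\mathcal P$ of the expected number of mistakes of the learner when the labelled examples of $S$ are played in order. - An adaptive adversary chooses each instance $x_t$ as a function of the past feedback sequence, and then a distribution $\tau^{(t)}$ on $\mathcal Y$ as a function of the past feedback sequence, of $x_t$, and of the distribution $\pi^{(t)}$ of the learner's prediction; the prediction and the correct label are then drawn independently from $\pi^{(t)}$ and $\tau^{(t)}$. A feedback sequence is realizable by $\mathcal P$ if some $p\in\mathcal P$ of the same length has the same instances and, in each round, a label that equals the prediction if the feedback was "correct" and differs from it if the feedback was "incorrect". The adversary is consistent with $\mathcal P$ if, for every realizable feedback sequence $F$, for the instance $x$ that it chooses after $F$, and for every distribution $\pi$ of the learner's prediction, appending $(x,\text{correct},y)$ to $F$ gives a realizable sequence for every $y$ in the support of the chosen distribution $\tau$. - $\mathsf{opt}^{\mathrm{adap}}_{\mathrm{bandit}}(\mathcal P)$ is the infimum over learners of the supremum over adaptive adversaries consistent with $\mathcal P$ of the expected number of mistakes of the learner in the whole game (the supremum over $T$ of the expected number of mistakes in the first $T$ rounds). -/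

import Mathlib

open scoped ENNReal NNReal

noncomputable section

namespace BanditLearning

/-- A pattern is a finite sequence of labelled examples; a pattern class is a non-empty set of
patterns that is closed under deleting examples. -/
structure PatternClass (X : Type*) (Y : Type*) where
  patterns : Set (List (X × Y))
  nonempty : patterns.Nonempty
  downward_closed : ∀ p ∈ patterns, ∀ q : List (X × Y), q.Sublist p → q ∈ patterns

/-- The number of examples of the pattern `p` that the hypothesis `h` labels incorrectly. -/
def inconsistencies {X Y : Type*} (h : X → Y) (p : List (X × Y)) : ℕ :=
  open Classical in p.countP fun e => decide (h e.1 ≠ e.2)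

/-- The patterns that agree with some `h ∈ H` in all but at most `B h` places. -/
def budgetPatterns {X Y : Type*} (H : Set (X → Y)) (B : H → ℝ) : Set (List (X × Y)) :=
  {p | ∃ h : H, (inconsistencies (h : X → Y) p : ℝ) ≤ B h}

/-- The concept class of all constant functions. -/
def constantFunctions (X Y : Type*) : Set (X → Y) :=
  Set.range (Function.const X)

/-- What the learner knows about one round after bandit feedback: the instance, whether its
prediction was correct, and its prediction. -/
structure Feedback (X : Type*) (Y : Type*) where
  inst : X
  correct : Bool
  pred : Y

/-- The feedback in a round with instance `x`, prediction `yhat` and correct label `y`. -/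
def banditFeedback {X Y : Type*} (x : X) (yhat y : Y) : Feedback X Y :=
  open Classical in ⟨x, decide (yhat = y), yhat⟩

/-- The number of mistakes recorded in a feedback sequence. -/
def mistakes {X Y : Type*} (F : List (Feedback X Y)) : ℕ :=
  F.countP fun f => !f.correct

/-- The expected number of mistakes when the feedback sequence of the game has law `μ`. -/
def expectedMistakes {X Y : Type*} (μ : PMF (List (Feedback X Y))) : ℝ≥0∞ :=
  ∑' F, μ F * (mistakes F : ℝ≥0∞)

/-- A randomized learner: past feedback (oldest round first) and the current instance determine
the distribution of the prediction. -/
def Learner (X : Type*) (Y : Type*) : Type _ :=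
  List (Feedback X Y) → X → PMF Y

/-- The law of the feedback sequence, when the feedback so far is `F` and the labelled examples in
the second list are still to be played. -/
def obliviousLaw {X Y : Type*} (L : Learner X Y) :
    List (Feedback X Y) → List (X × Y) → PMF (List (Feedback X Y))
  | F, [] => PMF.pure F
  | F, e :: S => (L F e.1).bind fun yhat => obliviousLaw L (F ++ [banditFeedback e.1 yhat e.2]) S

/-- The optimal bandit mistake bound of `P` against oblivious adversaries, which fix a sequence
`S ∈ P` in advance. -/
def optBanditObl {X Y : Type*} (P : PatternClass X Y) : ℝ≥0∞ :=
  ⨅ L : Learner X Y, ⨆ S ∈ P.patterns, expectedMistakes (obliviousLaw L [] S)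

/-- A pattern is consistent with a feedback sequence if in every round it has the same instance,
and its label equals the prediction exactly if the feedback was positive. -/
def ConsistentWith {X Y : Type*} (p : List (X × Y)) (F : List (Feedback X Y)) : Prop :=
  List.Forall₂ (fun e f => e.1 = f.inst ∧ (f.correct = true ↔ e.2 = f.pred)) p F

/-- A feedback sequence is realizable by `P` if some pattern of `P` is consistent with it. -/
def PatternClass.Realizes {X Y : Type*} (P : PatternClass X Y) (F : List (Feedback X Y)) : Prop :=
  ∃ p ∈ P.patterns, ConsistentWith p F

/-- An adaptive adversary: `inst` chooses the next instance from the past feedback, and `label`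
chooses the distribution of the correct label from the past feedback, the current instance and the
distribution of the learner's prediction. -/
structure Adversary (X : Type*) (Y : Type*) where
  inst : List (Feedback X Y) → X
  label : List (Feedback X Y) → X → PMF Y → PMF Y

/-- The adversary is consistent with `P` if, after every realizable feedback sequence and for every
distribution of the learner's prediction, every label it may draw keeps the game realizable even
when it is disclosed. -/
def Adversary.Consistent {X Y : Type*} (A : Adversary X Y) (P : PatternClass X Y) : Prop :=
  ∀ F : List (Feedback X Y), P.Realizes F → ∀ π : PMF Y,
    ∀ y ∈ (A.label F (A.inst F) π).support, P.Realizes (F ++ [⟨A.inst F, true, y⟩])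

/-- The law of the feedback sequence of the first `T` rounds against an adaptive adversary. In each
round the prediction and the correct label are drawn independently given the past. -/
def adaptiveLaw {X Y : Type*} (L : Learner X Y) (A : Adversary X Y) :
    ℕ → PMF (List (Feedback X Y))
  | 0 => PMF.pure []
  | T + 1 => (adaptiveLaw L A T).bind fun F =>
      (L F (A.inst F)).bind fun yhat =>
        (A.label F (A.inst F) (L F (A.inst F))).bind fun y =>
          PMF.pure (F ++ [banditFeedback (A.inst F) yhat y])

/-- The optimal bandit mistake bound of `P` against adaptive adversaries. The expected number of
mistakes in the whole game is the supremum over `T` of that in the first `T` rounds. -/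
def optBanditAdap {X Y : Type*} (P : PatternClass X Y) : ℝ≥0∞ :=
  ⨅ L : Learner X Y, ⨆ A : Adversary X Y, ⨆ _ : A.Consistent P,
    ⨆ T : ℕ, expectedMistakes (adaptiveLaw L A T)

end BanditLearning

end

open BanditLearning

/-!
The ratio bound follows from the other two, so the content is an upper bound `3k` against oblivious
adversaries and a lower bound `k² / 2` against adaptive ones.

**Upper bound.** The learner predicts uniformly at random until a prediction is correct, then
commits to that label until it has made `k + 1` mistakes with it, and then starts afresh. Let `y` be
the label that the sequence has in all but `n ≤ k` rounds. A commitment to `y` is never revoked and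
costs at most `n` mistakes. A commitment to another label costs at most `k + 1` mistakes, but can
only be made in one of the `n` exceptional rounds, and because the sequence is fixed in advance it
is made there with probability only `1 / k`. Hence the expected number of future mistakes of an
uncommitted learner is at most `k + 2n`
(`expectedMistakes_obliviousLaw_le`, by induction on the sequence).

**Lower bound.** The `cost` of a label `y` is the number of rounds of the feedback sequence that
contradict `y` being the correct label. A feedback sequence is realizable exactly when some label
has cost at most `k` (`realizes_iff`), so as long as some label has cost less than `k`, every label
may be declared correct. The adversary then declares the label that the learner is least likely to
predict, and this label has probability at most `1 / k`. A mistake raises the total cost of all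
labels by `1`, a correct prediction raises it by `k - 1`; so the total cost rises by at most twice
the probability of a mistake, in expectation (`expected_totalCost_increase_le`). The adversary can go on like
this while the total cost is below `k²`, and since every round raises the total cost by at least
`1`, that value is reached after `k²` rounds.
-/

open scoped ENNReal NNReal

noncomputable section

namespace BanditLearning

variable {X Y : Type*}

/-! ### Expectations -/

/-- The expectation of an extended nonnegative function under a probability mass function. -/
def expectation {α : Type*} (μ : PMF α) (g : α → ℝ≥0∞) : ℝ≥0∞ :=
  ∑' a, μ a * g a

theorem expectation_pure {α : Type*} (a : α) (g : α → ℝ≥0∞) :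
    expectation (PMF.pure a) g = g a := by
  unfold expectation
  rw [tsum_eq_single a]
  · simp
  · intro b hb
    simp [PMF.pure_apply, hb]

theorem expectation_bind {α β : Type*} (μ : PMF α) (f : α → PMF β) (g : β → ℝ≥0∞) :
    expectation (μ.bind f) g = expectation μ fun a => expectation (f a) g := by
  unfold expectation
  simp only [PMF.bind_apply, ← ENNReal.tsum_mul_right, ← ENNReal.tsum_mul_left]
  rw [ENNReal.tsum_comm]
  simp only [mul_assoc]

theorem expectation_mono {α : Type*} (μ : PMF α) {g h : α → ℝ≥0∞} (hgh : ∀ a, g a ≤ h a) :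
    expectation μ g ≤ expectation μ h :=
  ENNReal.tsum_le_tsum fun a => mul_le_mul_right (hgh a) _

theorem expectation_const {α : Type*} (μ : PMF α) (c : ℝ≥0∞) :
    expectation μ (fun _ => c) = c := by
  unfold expectation
  rw [ENNReal.tsum_mul_right, μ.tsum_coe, one_mul]

theorem expectation_add {α : Type*} (μ : PMF α) (g h : α → ℝ≥0∞) :
    expectation μ (fun a => g a + h a) = expectation μ g + expectation μ h := by
  unfold expectation
  simp only [mul_add, ENNReal.tsum_add]

theorem expectation_const_mul {α : Type*} (μ : PMF α) (c : ℝ≥0∞) (g : α → ℝ≥0∞) :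
    expectation μ (fun a => c * g a) = c * expectation μ g := by
  unfold expectation
  rw [← ENNReal.tsum_mul_left]
  exact tsum_congr fun a => mul_left_comm _ _ _

open Classical in
theorem expectation_ite {α : Type*} (μ : PMF α) (b : α) (u v : ℝ≥0∞) :
    expectation μ (fun a => if a = b then u else v) = μ b * u + (1 - μ b) * v := by
  have hsplit : ∀ a, (if a = b then u else v) =
      (if a = b then 1 else 0) * u + (if a = b then 0 else 1) * v := by
    intro a; split_ifs <;> simp
  have h1 : expectation μ (fun a => if a = b then 1 else 0) = μ b := by
    unfold expectation
    rw [tsum_eq_single b]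
    · simp
    · intro a ha; simp [ha]
  have h2 : expectation μ (fun a => if a = b then 0 else 1) = 1 - μ b := by
    refine ENNReal.eq_sub_of_add_eq (μ.apply_ne_top b) ?_
    rw [← h1, ← expectation_add]
    refine Eq.trans ?_ (expectation_const μ 1)
    congr 1
    funext a
    split_ifs <;> simp
  simp only [hsplit]
  rw [expectation_add]
  simp only [mul_comm _ u, mul_comm _ v]
  rw [expectation_const_mul, expectation_const_mul, h1, h2]

theorem expectedMistakes_eq_expectation (μ : PMF (List (Feedback X Y))) :
    expectedMistakes μ = expectation μ fun F => (mistakes F : ℝ≥0∞) := rfl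

open Classical in
theorem mistakes_append_banditFeedback (F : List (Feedback X Y)) (x : X) (yhat y : Y) :
    mistakes (F ++ [banditFeedback x yhat y]) = mistakes F + if yhat = y then 0 else 1 := by
  by_cases h : yhat = y <;> simp [mistakes, banditFeedback, List.countP_append, h]

/-! ### The class of constant functions with a budget -/

theorem inconsistencies_nil (h : X → Y) : inconsistencies h [] = 0 := rfl

open Classical in
theorem inconsistencies_const_cons (y : Y) (e : X × Y) (p : List (X × Y)) :
    inconsistencies (Function.const X y) (e :: p) =
      inconsistencies (Function.const X y) p + if e.2 = y then 0 else 1 := by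
  by_cases h : y = e.2 <;> simp [inconsistencies, h, eq_comm (a := e.2)]

theorem mem_budgetPatterns_constantFunctions (k : ℕ) (p : List (X × Y)) :
    p ∈ budgetPatterns (constantFunctions X Y) (fun _ => (k : ℝ)) ↔
      ∃ y : Y, inconsistencies (Function.const X y) p ≤ k := by
  constructor
  · rintro ⟨⟨_, y, rfl⟩, h⟩
    exact ⟨y, Nat.cast_le.1 h⟩
  · rintro ⟨y, h⟩
    exact ⟨⟨_, y, rfl⟩, Nat.cast_le.2 h⟩

/-- The class of constant functions with budget `k`. -/
def constantClass (X Y : Type*) [Nonempty Y] (k : ℕ) : PatternClass X Y where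
  patterns := budgetPatterns (constantFunctions X Y) (fun _ => (k : ℝ))
  nonempty := ⟨[], (mem_budgetPatterns_constantFunctions k []).2
    ⟨Classical.arbitrary Y, by simp [inconsistencies_nil]⟩⟩
  downward_closed p hp q hq := by
    rw [mem_budgetPatterns_constantFunctions] at hp ⊢
    obtain ⟨y, hy⟩ := hp
    exact ⟨y, le_trans hq.countP_le hy⟩

/-! ### The oblivious upper bound -/

/-- One round of feedback for the explore-then-commit learner. The state `none` means that the
learner explores; the state `some (y, m)` means that it is committed to `y`, and that the commitment
survives `m` more mistakes. -/
def commitStep (k : ℕ) (s : Option (Y × ℕ)) (f : Feedback X Y) : Option (Y × ℕ) :=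
  match s with
  | none => if f.correct then some (f.pred, k) else none
  | some (y, 0) => if f.correct then some (y, 0) else none
  | some (y, m + 1) => if f.correct then some (y, m + 1) else some (y, m)

/-- The state of the explore-then-commit learner after a feedback sequence. -/
def commitState (k : ℕ) (F : List (Feedback X Y)) : Option (Y × ℕ) :=
  F.foldl (commitStep k) none

theorem commitState_append (k : ℕ) (F : List (Feedback X Y)) (f : Feedback X Y) :
    commitState k (F ++ [f]) = commitStep k (commitState k F) f := by
  simp [commitState]

/-- The explore-then-commit learner: it predicts the label to which it is committed, and a uniformly
random label while it explores. -/
def commitLearner (X Y : Type*) [Fintype Y] [Nonempty Y] (k : ℕ) : Learner X Y := fun F _ =>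
  match commitState k F with
  | none => PMF.uniformOfFintype Y
  | some (y, _) => PMF.pure y

open Classical in
/-- Bound on the expected number of future mistakes of the explore-then-commit learner in a given
state, if `n` of the labels still to come differ from `y`. For a commitment to `y` itself, the bound
`n` is only meant for `n` at most the remaining tolerance, so that the commitment lasts. -/
def commitBound (k : ℕ) (y : Y) (n : ℕ) : Option (Y × ℕ) → ℕ
  | none => k + 2 * n
  | some (z, m) => if z = y then n else m + 1 + k + 2 * n

theorem expectedMistakes_obliviousLaw_le [Fintype Y] [Nonempty Y] (y : Y)
    (S : List (X × Y)) : ∀ F : List (Feedback X Y),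
    inconsistencies (Function.const X y) S ≤ Fintype.card Y →
    (∀ m, commitState (Fintype.card Y) F = some (y, m) →
      inconsistencies (Function.const X y) S ≤ m) →
    expectedMistakes (obliviousLaw (commitLearner X Y (Fintype.card Y)) F S) ≤
      ((mistakes F + commitBound (Fintype.card Y) y (inconsistencies (Function.const X y) S)
        (commitState (Fintype.card Y) F) : ℕ) : ℝ≥0∞) := by
  classical
  set k := Fintype.card Y with hk
  have hk0 : (k : ℝ≥0∞) ≠ 0 := by
    have : 0 < k := Fintype.card_pos
    exact_mod_cast this.ne'
  have hkt : (k : ℝ≥0∞) ≠ ⊤ := ENNReal.natCast_ne_top k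
  induction S with
  | nil =>
    intro F _ _
    rw [obliviousLaw, expectedMistakes_eq_expectation, expectation_pure]
    exact_mod_cast Nat.le_add_right _ _
  | cons e S ih =>
    intro F hn hm
    have hcons := inconsistencies_const_cons y e S
    set n' := inconsistencies (Function.const X y) (e :: S)
    set n := inconsistencies (Function.const X y) S
    have hnn : n ≤ n' := by rw [hcons]; exact Nat.le_add_right _ _
    rw [obliviousLaw, expectedMistakes_eq_expectation, expectation_bind]
    rcases hs : commitState k F with _ | ⟨z, m⟩
    · -- exploration: the prediction hits the label of the round with probability `1 / k`
      have hL : commitLearner X Y k F e.1 = PMF.uniformOfFintype Y := by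
        simp only [commitLearner, hs]
      have hstep : ∀ yhat, expectation
          (obliviousLaw (commitLearner X Y k) (F ++ [banditFeedback e.1 yhat e.2]) S)
            (fun F => (mistakes F : ℝ≥0∞)) ≤
          if yhat = e.2 then ((mistakes F + commitBound k y n (some (e.2, k)) : ℕ) : ℝ≥0∞)
          else ((mistakes F + (1 + (k + 2 * n)) : ℕ) : ℝ≥0∞) := by
        intro yhat
        have hst : commitState k (F ++ [banditFeedback e.1 yhat e.2]) =
            if yhat = e.2 then some (e.2, k) else none := by
          rw [commitState_append, hs]
          by_cases h : yhat = e.2 <;> simp [commitStep, banditFeedback, h]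
        refine (ih _ (hnn.trans hn) ?_).trans ?_
        · intro m' h'
          rw [hst] at h'
          split_ifs at h'
          simp only [Option.some.injEq, Prod.mk.injEq] at h'
          omega
        · rw [hst, mistakes_append_banditFeedback]
          split_ifs
          · simp
          · simp only [commitBound]; exact_mod_cast (by omega)
      rw [hL]
      refine (expectation_mono _ hstep).trans ?_
      rw [expectation_ite, PMF.uniformOfFintype_apply, ← hk]
      -- multiplied by `k`, the inequality is one between natural numbers
      rw [← ENNReal.mul_le_mul_iff_right hk0 hkt, mul_add, ← mul_assoc, ← mul_assoc,
        ENNReal.mul_inv_cancel hk0 hkt, one_mul, ENNReal.mul_sub (fun _ _ => hkt), mul_one,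
        ENNReal.mul_inv_cancel hk0 hkt]
      have hcast : (k : ℝ≥0∞) - 1 = ((k - 1 : ℕ) : ℝ≥0∞) := by simp
      rw [hcast, hcons]
      have hk1 : 1 ≤ k := Fintype.card_pos
      obtain ⟨j, hj⟩ : ∃ j, k = j + 1 := ⟨k - 1, by omega⟩
      have hle : n ≤ k := hnn.trans hn
      simp only [commitBound]
      by_cases h : e.2 = y
      · simp only [h, if_true]
        norm_cast
        rw [hj] at hle ⊢
        simp only [Nat.add_sub_cancel]
        nlinarith
      · simp only [h, if_false]
        norm_cast
        rw [hj]
        simp only [Nat.add_sub_cancel]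
        nlinarith
    · have hL : commitLearner X Y k F e.1 = PMF.pure z := by
        simp only [commitLearner, hs]
      rw [hL, expectation_pure]
      have hst : commitState k (F ++ [banditFeedback e.1 z e.2]) =
          if z = e.2 then some (z, m) else if m = 0 then none else some (z, m - 1) := by
        rw [commitState_append, hs]
        rcases m with _ | m <;> by_cases h : z = e.2 <;> simp [commitStep, banditFeedback, h]
      have hm' : z = y → n' ≤ m := fun h => hm m (by rw [hs, h])
      refine (ih _ (hnn.trans hn) ?_).trans ?_
      · intro m' h'
        rw [hst] at h'
        split_ifs at h' with h1 h2
        · simp only [Option.some.injEq, Prod.mk.injEq] at h'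
          have := hm' h'.1
          omega
        · simp only [Option.some.injEq, Prod.mk.injEq] at h'
          have := hm' h'.1
          rw [hcons, if_neg (fun h => h1 (h'.1.trans h.symm))] at this
          omega
      · rw [hst, mistakes_append_banditFeedback]
        refine Nat.cast_le.2 ?_
        by_cases hzy : z = y
        · have := hm' hzy
          subst hzy
          by_cases h1 : z = e.2
          · simp only [h1, if_true, commitBound]; omega
          · rw [if_neg (Ne.symm h1)] at hcons
            have hm0 : m ≠ 0 := by omega
            simp only [h1, hm0, if_true, if_false, commitBound]
            omega
        · by_cases h1 : z = e.2
          · have : e.2 ≠ y := h1 ▸ hzy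
            simp only [h1, this, if_true, if_false, commitBound]; omega
          · by_cases hm0 : m = 0
            · simp only [h1, hm0, hzy, if_true, if_false, commitBound]; omega
            · simp only [h1, hm0, hzy, if_false, commitBound]; omega

theorem optBanditObl_constantClass_le [Fintype Y] [Nonempty Y] :
    optBanditObl (constantClass X Y (Fintype.card Y)) ≤ 3 * (Fintype.card Y : ℝ≥0∞) := by
  refine (iInf_le _ (commitLearner X Y (Fintype.card Y))).trans (iSup₂_le fun S hS => ?_)
  obtain ⟨y, hy⟩ := (mem_budgetPatterns_constantFunctions _ S).1 hS
  refine (expectedMistakes_obliviousLaw_le y S [] hy ?_).trans ?_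
  · intro m h
    simp [commitState] at h
  · have : mistakes ([] : List (Feedback X Y)) = 0 := rfl
    simp only [this, commitState, List.foldl_nil, commitBound]
    exact_mod_cast (by omega)

/-! ### Costs of labels and realizability -/

open Classical in
/-- The number of rounds of a feedback sequence that contradict `y` being the correct label:
another label was correct, or `y` was incorrect. -/
def cost (y : Y) (F : List (Feedback X Y)) : ℕ :=
  F.countP fun f => decide (f.correct = true ↔ f.pred ≠ y)

open Classical in
theorem cost_cons (y : Y) (f : Feedback X Y) (F : List (Feedback X Y)) :
    cost y (f :: F) = cost y F + if (f.correct = true ↔ f.pred ≠ y) then 1 else 0 := by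
  simp only [cost, List.countP_cons, decide_eq_true_eq]

open Classical in
theorem cost_append (y : Y) (F : List (Feedback X Y)) (f : Feedback X Y) :
    cost y (F ++ [f]) = cost y F + if (f.correct = true ↔ f.pred ≠ y) then 1 else 0 := by
  simp only [cost, List.countP_append, List.countP_singleton, decide_eq_true_eq]

theorem cost_le_inconsistencies (y : Y) {p : List (X × Y)} {F : List (Feedback X Y)}
    (h : ConsistentWith p F) : cost y F ≤ inconsistencies (Function.const X y) p := by
  classical
  unfold ConsistentWith at h
  induction h with
  | nil => exact le_rfl
  | @cons e f p F hef _ ih =>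
    rw [cost_cons, inconsistencies_const_cons]
    refine Nat.add_le_add ih ?_
    by_cases hy : e.2 = y
    · have : ¬(f.correct = true ↔ f.pred ≠ y) := by
        rw [hef.2, hy, eq_comm]; tauto
      simp [this]
    · rw [if_neg hy]
      split_ifs <;> simp

theorem exists_consistentWith [Nontrivial Y] (y : Y) (F : List (Feedback X Y)) :
    ∃ p : List (X × Y), ConsistentWith p F ∧
      inconsistencies (Function.const X y) p = cost y F := by
  classical
  induction F with
  | nil => exact ⟨[], List.Forall₂.nil, rfl⟩
  | cons f F ih =>
    obtain ⟨p, hp, hc⟩ := ih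
    suffices h : ∃ z : Y, (f.correct = true ↔ z = f.pred) ∧
        (z = y ↔ ¬(f.correct = true ↔ f.pred ≠ y)) by
      obtain ⟨z, hz, hzy⟩ := h
      refine ⟨(f.inst, z) :: p, List.Forall₂.cons ⟨rfl, hz⟩ hp, ?_⟩
      rw [inconsistencies_const_cons, cost_cons, hc]
      congr 1
      by_cases h : (f.correct = true ↔ f.pred ≠ y) <;> simp [hzy, h]
    by_cases hcor : f.correct = true
    · exact ⟨f.pred, by simp [hcor], by simp [hcor]⟩
    · by_cases hpy : f.pred = y
      · obtain ⟨z, hz⟩ := exists_ne y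
        exact ⟨z, by simp [hcor, hpy, hz], by simp [hcor, hpy, hz]⟩
      · exact ⟨y, by simp [hcor, Ne.symm hpy], by simp [hcor, hpy]⟩

theorem realizes_iff [Nontrivial Y] (k : ℕ) (F : List (Feedback X Y)) :
    (constantClass X Y k).Realizes F ↔ ∃ y : Y, cost y F ≤ k := by
  constructor
  · rintro ⟨p, hp, hpF⟩
    obtain ⟨y, hy⟩ := (mem_budgetPatterns_constantFunctions k p).1 hp
    exact ⟨y, (cost_le_inconsistencies y hpF).trans hy⟩
  · rintro ⟨y, hy⟩
    obtain ⟨p, hp, hc⟩ := exists_consistentWith y F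
    exact ⟨p, (mem_budgetPatterns_constantFunctions k p).2 ⟨y, hc.trans_le hy⟩, hp⟩

/-- The total cost of all labels. -/
def totalCost [Fintype Y] (F : List (Feedback X Y)) : ℕ :=
  ∑ y : Y, cost y F

theorem totalCost_append [Fintype Y] (F : List (Feedback X Y)) (f : Feedback X Y) :
    totalCost (F ++ [f]) = totalCost F + if f.correct then Fintype.card Y - 1 else 1 := by
  classical
  unfold totalCost
  simp only [cost_append, Finset.sum_add_distrib]
  congr 1
  rw [← Finset.card_filter]
  by_cases h : f.correct = true
  · simp only [h, true_iff, if_true, ← Finset.card_univ]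
    rw [← Finset.card_erase_of_mem (Finset.mem_univ f.pred)]
    congr 1
    ext z
    simp [eq_comm]
  · simp only [h, Bool.false_eq_true, false_iff, not_not, if_false]
    rw [Finset.card_eq_one]
    exact ⟨f.pred, by ext z; simp [eq_comm]⟩

theorem length_le_totalCost [Fintype Y] [Nontrivial Y] (F : List (Feedback X Y)) :
    F.length ≤ totalCost F := by
  have hk : 1 < Fintype.card Y := Fintype.one_lt_card
  induction F using List.reverseRecOn with
  | nil => simp
  | append_singleton F f ih =>
    rw [totalCost_append, List.length_append, List.length_singleton]
    split_ifs <;> omega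

/-! ### The adaptive lower bound -/

theorem exists_apply_le_inv_card [Fintype Y] [Nonempty Y] (π : PMF Y) :
    ∃ y, π y ≤ (Fintype.card Y : ℝ≥0∞)⁻¹ := by
  by_contra! h
  have hsum : ∑ y, π y = 1 := by
    have h := π.tsum_coe
    rwa [tsum_fintype] at h
  have hlt : ∑ _y : Y, (Fintype.card Y : ℝ≥0∞)⁻¹ < ∑ y, π y :=
    ENNReal.sum_lt_sum_of_nonempty Finset.univ_nonempty fun y _ => h y
  rw [hsum, Finset.sum_const, nsmul_eq_mul, Finset.card_univ,
    ENNReal.mul_inv_cancel (by simp) (by simp)] at hlt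
  exact lt_irrefl _ hlt

/-- A label whose probability is at most the average. -/
def leastLikely [Fintype Y] [Nonempty Y] (π : PMF Y) : Y :=
  (exists_apply_le_inv_card π).choose

theorem apply_leastLikely_le [Fintype Y] [Nonempty Y] (π : PMF Y) :
    π (leastLikely π) ≤ (Fintype.card Y : ℝ≥0∞)⁻¹ :=
  (exists_apply_le_inv_card π).choose_spec

open Classical in
/-- The adversary that declares an unlikely label correct while the total cost is below `k²`, and
from then on a label that does not exceed the budget, if there is one. -/
def costAdversary (x : X) (Y : Type*) [Fintype Y] [Nonempty Y] : Adversary X Y where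
  inst _ := x
  label F _ π :=
    if totalCost F < Fintype.card Y ^ 2 then PMF.pure (leastLikely π)
    else if h : ∃ y : Y, cost y F ≤ Fintype.card Y then PMF.pure h.choose
    else π

theorem costAdversary_consistent (x : X) [Fintype Y] [Nontrivial Y] :
    (costAdversary x Y).Consistent (constantClass X Y (Fintype.card Y)) := by
  classical
  intro F hF π y hy
  rw [realizes_iff] at hF ⊢
  by_cases hlt : totalCost F < Fintype.card Y ^ 2
  · -- some label has cost at most `k - 1`, so any label may be declared correct
    obtain ⟨z, hz⟩ : ∃ z : Y, cost z F < Fintype.card Y := by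
      by_contra! h
      have := Finset.card_nsmul_le_sum Finset.univ (fun z : Y => cost z F) _ fun z _ => h z
      rw [Finset.card_univ, smul_eq_mul, ← sq] at this
      exact absurd hlt (not_lt.2 this)
    refine ⟨z, ?_⟩
    rw [cost_append]
    split_ifs <;> omega
  · simp only [costAdversary, if_neg hlt, dif_pos hF, PMF.support_pure,
      Set.mem_singleton_iff] at hy
    refine ⟨y, ?_⟩
    rw [cost_append, if_neg (by simp), hy]
    exact hF.choose_spec

/-- If the label that is declared correct is predicted with probability `q ≤ 1 / k`, the expected increase
of the total cost is at most twice the probability of a mistake. -/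
theorem expected_totalCost_increase_le {k : ℕ} {q : ℝ≥0∞} (hk : 2 ≤ k) (hq : q ≤ (k : ℝ≥0∞)⁻¹) :
    q * ((k - 1 : ℕ) : ℝ≥0∞) + (1 - q) * 1 ≤ 2 * (1 - q) := by
  rw [mul_one, two_mul]
  refine add_le_add_left ?_ _
  have hk0 : (k : ℝ≥0∞) ≠ 0 := by exact_mod_cast (by omega : k ≠ 0)
  have hqt : q ≠ ⊤ := ne_top_of_le_ne_top (ENNReal.inv_ne_top.2 hk0) hq
  refine ENNReal.le_sub_of_add_le_right hqt ?_
  calc q * ((k - 1 : ℕ) : ℝ≥0∞) + q = q * ((k - 1 + 1 : ℕ) : ℝ≥0∞) := by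
        rw [Nat.cast_add, Nat.cast_one, mul_add, mul_one]
    _ = q * k := by rw [Nat.sub_add_cancel (by omega)]
    _ ≤ (k : ℝ≥0∞)⁻¹ * k := mul_le_mul_left hq _
    _ = 1 := ENNReal.inv_mul_cancel hk0 (ENNReal.natCast_ne_top k)

/-- The total cost, truncated at `k²`, grows at most twice as fast as the number of mistakes. -/
theorem expectation_totalCost_le (x : X) [Fintype Y] [Nontrivial Y] (L : Learner X Y) (T : ℕ) :
    expectation (adaptiveLaw L (costAdversary x Y) T)
        (fun F => ((min (totalCost F) (Fintype.card Y ^ 2) : ℕ) : ℝ≥0∞)) ≤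
      2 * expectedMistakes (adaptiveLaw L (costAdversary x Y) T) := by
  classical
  have hk : 1 < Fintype.card Y := Fintype.one_lt_card
  induction T with
  | zero =>
    rw [adaptiveLaw, expectation_pure]
    simp [totalCost, cost]
  | succ T ih =>
    rw [adaptiveLaw, expectedMistakes_eq_expectation, expectation_bind, expectation_bind]
    rw [expectedMistakes_eq_expectation] at ih
    set μ := adaptiveLaw L (costAdversary x Y) T
    simp only [expectation_bind, expectation_pure, mistakes_append_banditFeedback,
      totalCost_append, Nat.cast_add, expectation_add, expectation_const, mul_add]
    set A := costAdversary x Y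
    set E : List (Feedback X Y) → ℝ≥0∞ := fun F =>
      expectation (L F (A.inst F)) fun yhat =>
        expectation (A.label F (A.inst F) (L F (A.inst F))) fun y =>
          ((if yhat = y then 0 else 1 : ℕ) : ℝ≥0∞) with hE
    rw [← expectation_const_mul μ 2 E]
    refine le_trans ?_ (add_le_add_left ih _)
    rw [← expectation_add]
    refine expectation_mono _ fun F => ?_
    by_cases hlt : totalCost F < Fintype.card Y ^ 2
    · set π := L F (A.inst F)
      have hlab : A.label F (A.inst F) π = PMF.pure (leastLikely π) := by
        simp only [A, costAdversary, if_pos hlt]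
      have hEF : E F = 1 - π (leastLikely π) := by
        have h := expectation_ite π (leastLikely π) 0 1
        simp only [mul_zero, zero_add, mul_one] at h
        rw [← h, hE]
        simp only [hlab, expectation_pure, π]
        congr 1
        funext yhat
        split_ifs <;> simp
      rw [hlab, hEF]
      simp only [expectation_pure]
      refine le_trans (expectation_mono _ (h := fun yhat => ((totalCost F : ℕ) : ℝ≥0∞) +
        if yhat = leastLikely π then ((Fintype.card Y - 1 : ℕ) : ℝ≥0∞) else 1) ?_) ?_
      · intro yhat
        refine (Nat.cast_le.2 (min_le_left _ _)).trans ?_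
        by_cases h : yhat = leastLikely π <;> simp [banditFeedback, h]
      · rw [expectation_add, expectation_const, expectation_ite, min_eq_left hlt.le]
        exact add_le_add_right (expected_totalCost_increase_le hk (apply_leastLikely_le π)) _
    · -- the truncated cost does not grow any more
      rw [min_eq_right (not_lt.1 hlt)]
      refine le_trans ?_ (le_add_right le_rfl)
      rw [← expectation_const (L F (A.inst F)) ((Fintype.card Y ^ 2 : ℕ) : ℝ≥0∞)]
      refine expectation_mono _ fun yhat => ?_
      rw [← expectation_const (A.label F (A.inst F) (L F (A.inst F)))
        ((Fintype.card Y ^ 2 : ℕ) : ℝ≥0∞)]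
      exact expectation_mono _ fun y => Nat.cast_le.2 (min_le_right _ _)

theorem length_eq_of_mem_support_adaptiveLaw (L : Learner X Y) (A : Adversary X Y) (T : ℕ) :
    ∀ F ∈ (adaptiveLaw L A T).support, F.length = T := by
  induction T with
  | zero =>
    intro F hF
    simp only [adaptiveLaw, PMF.support_pure, Set.mem_singleton_iff] at hF
    simp [hF]
  | succ T ih =>
    intro F hF
    simp only [adaptiveLaw, PMF.mem_support_bind_iff, PMF.support_pure,
      Set.mem_singleton_iff] at hF
    obtain ⟨G, hG, _, _, _, _, rfl⟩ := hF
    simp [ih G hG]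

theorem sq_card_le_expectedMistakes (x : X) [Fintype Y] [Nontrivial Y] (L : Learner X Y) :
    (Fintype.card Y : ℝ≥0∞) ^ 2 ≤
      2 * expectedMistakes (adaptiveLaw L (costAdversary x Y) (Fintype.card Y ^ 2)) := by
  refine le_trans ?_ (expectation_totalCost_le x L (Fintype.card Y ^ 2))
  rw [← expectation_const (adaptiveLaw L (costAdversary x Y) (Fintype.card Y ^ 2))
    ((Fintype.card Y : ℝ≥0∞) ^ 2)]
  refine ENNReal.tsum_le_tsum fun F => ?_
  by_cases hF : F ∈ (adaptiveLaw L (costAdversary x Y) (Fintype.card Y ^ 2)).support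
  · have hlen := length_eq_of_mem_support_adaptiveLaw L _ _ F hF
    have := length_le_totalCost F
    beta_reduce
    rw [min_eq_right (hlen ▸ this)]
    simp
  · rw [PMF.mem_support_iff, not_not] at hF
    simp [hF]

theorem sq_card_le_optBanditAdap [Nonempty X] [Fintype Y] [Nontrivial Y] :
    2⁻¹ * (Fintype.card Y : ℝ≥0∞) ^ 2 ≤
      optBanditAdap (constantClass X Y (Fintype.card Y)) := by
  obtain ⟨x⟩ := ‹Nonempty X›
  refine le_iInf fun L => ?_
  refine le_trans ?_ (le_iSup₂_of_le (costAdversary x Y) (costAdversary_consistent x)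
    (le_iSup _ (Fintype.card Y ^ 2)))
  calc 2⁻¹ * (Fintype.card Y : ℝ≥0∞) ^ 2
      ≤ 2⁻¹ * (2 * expectedMistakes (adaptiveLaw L (costAdversary x Y) (Fintype.card Y ^ 2))) :=
        mul_le_mul_right (sq_card_le_expectedMistakes x L) _
    _ = _ := by rw [← mul_assoc, ENNReal.inv_mul_cancel (by simp) (by simp), one_mul]

end BanditLearning

end

open BanditLearning
theorem mainTheorem6 :
    ∃ c c' C : ℝ≥0, 0 < c ∧ 0 < c' ∧
      ∀ k : ℕ, 2 ≤ k →
        ∀ (X : Type*) [Nonempty X] (Y : Type*) [Fintype Y], Fintype.card Y = k →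
          ∃ P : PatternClass X Y,
            P.patterns = budgetPatterns (constantFunctions X Y) (fun _ => (k : ℝ)) ∧
            (c : ℝ≥0∞) * ((k : ℝ≥0∞) * optBanditObl P) ≤ optBanditAdap P ∧
            (c' : ℝ≥0∞) * (k : ℝ≥0∞) ^ 2 ≤ optBanditAdap P ∧
            optBanditObl P ≤ (C : ℝ≥0∞) * (k : ℝ≥0∞) := by
  refine ⟨2⁻¹ * 3⁻¹, 2⁻¹, 3, by positivity, by positivity, ?_⟩
  intro k hk X _ Y _ hY
  subst hY
  have : Nontrivial Y := Fintype.one_lt_card_iff_nontrivial.1 hk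
  have hlow := sq_card_le_optBanditAdap (X := X) (Y := Y)
  have hup := optBanditObl_constantClass_le (X := X) (Y := Y)
  have h2 : ((2⁻¹ : ℝ≥0) : ℝ≥0∞) = 2⁻¹ := by simp
  have h3 : ((3⁻¹ : ℝ≥0) : ℝ≥0∞) = 3⁻¹ := by simp
  refine ⟨constantClass X Y (Fintype.card Y), rfl, ?_, by rwa [h2], by simpa using hup⟩
  refine le_trans ?_ hlow
  rw [ENNReal.coe_mul, h2, h3, mul_assoc]
  refine mul_le_mul_right ?_ _
  calc (3⁻¹ : ℝ≥0∞) * ((Fintype.card Y : ℝ≥0∞) * optBanditObl _)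
      ≤ 3⁻¹ * ((Fintype.card Y : ℝ≥0∞) * (3 * (Fintype.card Y : ℝ≥0∞))) := by gcongr
    _ = (3⁻¹ * 3) * (Fintype.card Y : ℝ≥0∞) ^ 2 := by ring
    _ = (Fintype.card Y : ℝ≥0∞) ^ 2 := by
        rw [ENNReal.inv_mul_cancel (by simp) (by simp), one_mul]
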